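/- Let $(M,g)$ be a connected, compact $\mathcal C^\infty$ Riemannian manifold without boundary, of dimension $n\ge 1$, and let $\Psi:M\to\mathbb R$ be a $\mathcal C^\infty$ function. Let $\nabla$ be the Levi-Civita connection, let $\cdot$ and $|\cdot|$ be the scalar product and norm induced by $g$ on tangent vectors and on covectors, and write $\eta^*$ for the vector field dual to a $1$-form $\eta$ ($\eta^i=g^{ij}\eta_j$). Put $$Lf=\Delta f-\nabla\Psi\cdot\nabla f,\qquad \delta_\Psi\eta=\nabla\cdot\eta^*-\nabla\Psi\cdot\eta^*=g^{ij}(\nabla_i\eta_j-\partial_i\Psi\,\eta_j),\qquad Ricci(L)=Ricci_g+\mathrm{Hess}(\Psi),$$ for functions $f$ and $1$-forms $\eta$, where $\Delta=\nabla\cdot\nabla$. For a $2$-form $\beta$ let $(\delta_\Psi\beta)_j=g^{ki}(\nabla_k\beta_{ij}-\partial_k\Psi\,\beta_{ij})$; thus $\delta_\Psi$ is, up to sign, the formal adjoint of the exterior derivative $d$ with respect to the measure $e^{-\Psi}dx$, where $dx$ is the Riemannian measure. Let $\overrightarrow{L}\eta=d\,\delta_\Psi\eta+\delta_\Psi\,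 d\eta$ be the (weighted) Hodge-de Rham operator on $1$-forms, with the analyst's sign convention. Assume that $R\in\mathbb R$ and the real number $m\ge n$ are such that, everywhere on $M$ and as symmetric tensors, $$Ricci(L)\ \ge\ R\,g+\frac1{m-n}\nabla\Psi\otimes\nabla\Psi ,$$ where, if $m=n$, it is required that $\Psi=0$ and the last term is read as $0$. Then for all smooth $1$-forms $\eta,\alpha$ and all $b\in\mathbb R$, at every point of $M$, $$L\frac{|\eta|^2}{2}-\eta\cdot\overrightarrow{L}\eta+2b\,\alpha\cdot d|\eta|^2+4b^2|\alpha|^2|\eta|^2\ \ge\ \frac1m\big(\delta_\Psi\eta+2b\,\alpha\cdot\eta\big)^2+R|\eta|^2 .$$ -/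

import Mathlib

open Bundle Manifold
open scoped ContDiff

namespace WeightedRiem

/-! ### Tensor calculus in one system of local coordinates

A metric is given here by its coefficient matrix `G y = (g_ij(y))`, a `1`-form by its components
`η i y`, a `2`-form by its components `β i j y`, all of them functions of the coordinate vector
`y ∈ ℝⁿ`. -/

section LocalCoordinates

variable {n : ℕ}

/-- The partial derivative `∂_i f` at `y`. -/
noncomputable def pd (i : Fin n) (f : EuclideanSpace ℝ (Fin n) → ℝ)
    (y : EuclideanSpace ℝ (Fin n)) : ℝ :=
  fderiv ℝ f y (EuclideanSpace.single i 1)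

variable (G : EuclideanSpace ℝ (Fin n) → Matrix (Fin n) (Fin n) ℝ)
  (psi : EuclideanSpace ℝ (Fin n) → ℝ)

/-- The Christoffel symbol `Γ_{ij}^p = ½ g^{pl} (∂_i g_{jl} + ∂_j g_{il} - ∂_l g_{ij})`. -/
noncomputable def christoffel (p i j : Fin n) (y : EuclideanSpace ℝ (Fin n)) : ℝ :=
  (1 / 2) * ∑ l, (G y)⁻¹ p l *
    (pd i (fun z ↦ G z j l) y + pd j (fun z ↦ G z i l) y - pd l (fun z ↦ G z i j) y)

/-- The components of the Ricci tensor,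
`Ric_{jk} = ∂_i Γ_{jk}^i - ∂_j Γ_{ik}^i + Γ_{ip}^i Γ_{jk}^p - Γ_{jp}^i Γ_{ik}^p`
(positive on round spheres). -/
noncomputable def ricciCoord (j k : Fin n) (y : EuclideanSpace ℝ (Fin n)) : ℝ :=
  ∑ i, (pd i (christoffel G i j k) y - pd j (christoffel G i i k) y +
    ∑ p, (christoffel G i i p y * christoffel G p j k y -
      christoffel G i j p y * christoffel G p i k y))

/-- The components of the covariant derivative of a `1`-form,
`∇_i η_j = ∂_i η_j - Γ_{ij}^p η_p`. -/
noncomputable def covDeriv (η : Fin n → EuclideanSpace ℝ (Fin n) → ℝ) (i j : Fin n)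
    (y : EuclideanSpace ℝ (Fin n)) : ℝ :=
  pd i (η j) y - ∑ p, christoffel G p i j y * η p y

/-- The components of the covariant derivative of a covariant `2`-tensor,
`∇_k β_{ij} = ∂_k β_{ij} - Γ_{ki}^p β_{pj} - Γ_{kj}^p β_{ip}`. -/
noncomputable def covDerivTwo (β : Fin n → Fin n → EuclideanSpace ℝ (Fin n) → ℝ) (k i j : Fin n)
    (y : EuclideanSpace ℝ (Fin n)) : ℝ :=
  pd k (β i j) y - ∑ p, (christoffel G p k i y * β p j y + christoffel G p k j y * β i p y)

/-- The components of `Hess Ψ = ∇dΨ`. -/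
noncomputable def hessCoord (i j : Fin n) (y : EuclideanSpace ℝ (Fin n)) : ℝ :=
  covDeriv G (fun k ↦ pd k psi) i j y

/-- The weighted divergence of a `1`-form,
`δ_Ψ η = g^{ij} ∇_i η_j - g^{ij} ∂_i Ψ η_j`. -/
noncomputable def divCoord (η : Fin n → EuclideanSpace ℝ (Fin n) → ℝ)
    (y : EuclideanSpace ℝ (Fin n)) : ℝ :=
  ∑ i, ∑ j, (G y)⁻¹ i j * (covDeriv G η i j y - pd i psi y * η j y)

/-- The generator `L f = Δ f - ∇Ψ · ∇f`, with `Δ f = g^{ij} ∇_i ∂_j f`. -/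
noncomputable def genCoord (f : EuclideanSpace ℝ (Fin n) → ℝ)
    (y : EuclideanSpace ℝ (Fin n)) : ℝ :=
  ∑ i, ∑ j, (G y)⁻¹ i j * hessCoord G f i j y - ∑ i, ∑ j, (G y)⁻¹ i j * pd i psi y * pd j f y

/-- The components of the exterior derivative of a `1`-form,
`(dη)_{ij} = ∂_i η_j - ∂_j η_i`. -/
noncomputable def extDerivCoord (η : Fin n → EuclideanSpace ℝ (Fin n) → ℝ) (i j : Fin n)
    (y : EuclideanSpace ℝ (Fin n)) : ℝ :=
  pd i (η j) y - pd j (η i) y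

/-- The weighted divergence of a `2`-form,
`(δ_Ψ β)_j = g^{ki} ∇_k β_{ij} - g^{ki} ∂_k Ψ β_{ij}`. Up to the sign (the analyst's one, as for
`1`-forms) this is the formal adjoint of `d` with respect to the measure `e^{-Ψ} dx`. -/
noncomputable def divTwoCoord (β : Fin n → Fin n → EuclideanSpace ℝ (Fin n) → ℝ) (j : Fin n)
    (y : EuclideanSpace ℝ (Fin n)) : ℝ :=
  ∑ k, ∑ i, (G y)⁻¹ k i * (covDerivTwo G β k i j y - pd k psi y * β i j y)

/-- The components of the Hodge-de Rham operator `(d δ_Ψ + δ_Ψ d) η`. -/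
noncomputable def hodgeCoord (η : Fin n → EuclideanSpace ℝ (Fin n) → ℝ) (i : Fin n)
    (y : EuclideanSpace ℝ (Fin n)) : ℝ :=
  pd i (divCoord G psi η) y + divTwoCoord G psi (extDerivCoord η) i y

end LocalCoordinates

/-! ### The corresponding objects on a Riemannian manifold

Differential operators are evaluated at `x` in the preferred chart at `x`; since they are given by
tensorial formulas, any other chart of the smooth structure around `x` would give the same value. -/

section Manifold

variable {n : ℕ} {M : Type*} [TopologicalSpace M] [ChartedSpace (EuclideanSpace ℝ (Fin n)) M]

/-- The coordinate vector field `∂_i` of the chart `e`, at the point with coordinates `y`. -/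
noncomputable def frame (e : OpenPartialHomeomorph M (EuclideanSpace ℝ (Fin n)))
    (y : EuclideanSpace ℝ (Fin n)) (i : Fin n) : TangentSpace (𝓡 n) (e.symm y) :=
  mfderiv 𝓘(ℝ, EuclideanSpace ℝ (Fin n)) (𝓡 n) e.symm y (EuclideanSpace.single i (1 : ℝ))

/-- The coordinate differentials `dx^i` at `x`, for the preferred chart at `x`. -/
noncomputable def coframe (x : M) (i : Fin n) : TangentSpace (𝓡 n) x →L[ℝ] ℝ :=
  (EuclideanSpace.proj i : EuclideanSpace ℝ (Fin n) →L[ℝ] ℝ).comp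
    (mvfderiv (𝓡 n) (chartAt (EuclideanSpace ℝ (Fin n)) x) x)

/-- The components `η_i = η(∂_i)` of a `1`-form in the chart `e`. -/
noncomputable def formCoord (η : ∀ x : M, TangentSpace (𝓡 n) x →L[ℝ] ℝ)
    (e : OpenPartialHomeomorph M (EuclideanSpace ℝ (Fin n)))
    (i : Fin n) (y : EuclideanSpace ℝ (Fin n)) : ℝ :=
  η (e.symm y) (frame e y i)

/-- Smoothness of a `1`-form, as a section of the cotangent bundle. -/
def IsSmoothForm [IsManifold (𝓡 n) ∞ M] (η : ∀ x : M, TangentSpace (𝓡 n) x →L[ℝ] ℝ) : Prop :=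
  ContMDiff (𝓡 n) ((𝓡 n).prod 𝓘(ℝ, EuclideanSpace ℝ (Fin n) →L[ℝ] ℝ)) ∞
    (fun x ↦ TotalSpace.mk' (EuclideanSpace ℝ (Fin n) →L[ℝ] ℝ)
      (E := fun x : M ↦ TangentSpace (𝓡 n) x →L[ℝ] Bundle.Trivial M ℝ x) x (η x))

variable [IsManifold (𝓡 n) ∞ M]
  (g : ContMDiffRiemannianMetric (𝓡 n) ∞ (EuclideanSpace ℝ (Fin n))
    (fun x : M ↦ TangentSpace (𝓡 n) x))

/-- The metric coefficients `g_ij = g(∂_i, ∂_j)` in the chart `e`. -/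
noncomputable def metricCoord (e : OpenPartialHomeomorph M (EuclideanSpace ℝ (Fin n)))
    (y : EuclideanSpace ℝ (Fin n)) : Matrix (Fin n) (Fin n) ℝ :=
  Matrix.of fun i j ↦ g.inner (e.symm y) (frame e y i) (frame e y j)

theorem exists_sharp (x : M) (σ : TangentSpace (𝓡 n) x →L[ℝ] ℝ) :
    ∃ v : TangentSpace (𝓡 n) x, ∀ w, g.inner x v w = σ w := by
  have : FiniteDimensional ℝ (TangentSpace (𝓡 n) x) :=
    inferInstanceAs (FiniteDimensional ℝ (EuclideanSpace ℝ (Fin n)))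
  let B : TangentSpace (𝓡 n) x →ₗ[ℝ] Module.Dual ℝ (TangentSpace (𝓡 n) x) :=
    { toFun := fun v ↦ (g.inner x v : TangentSpace (𝓡 n) x →L[ℝ] ℝ).toLinearMap
      map_add' := fun v w ↦ by ext; simp
      map_smul' := fun c v ↦ by ext; simp }
  have hinj : Function.Injective B := by
    rw [injective_iff_map_eq_zero]
    intro v hv
    by_contra hne
    have h := g.pos x v hne
    have h2 : g.inner x v v = 0 := LinearMap.congr_fun hv v
    exact absurd h2 h.ne'
  have hsurj : Function.Surjective B :=
    (LinearMap.injective_iff_surjective_of_finrank_eq_finrank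
      (Subspace.dual_finrank_eq).symm).1 hinj
  obtain ⟨v, hv⟩ := hsurj σ.toLinearMap
  exact ⟨v, fun w ↦ LinearMap.congr_fun hv w⟩

/-- The tangent vector `σ^*` dual to the covector `σ`: `g(σ^*, w) = σ(w)` for all `w`. -/
noncomputable def sharp (x : M) (σ : TangentSpace (𝓡 n) x →L[ℝ] ℝ) : TangentSpace (𝓡 n) x :=
  (exists_sharp g x σ).choose

/-- The Riemannian scalar product `σ · θ` of two covectors at `x`. -/
noncomputable def formInner (x : M) (σ θ : TangentSpace (𝓡 n) x →L[ℝ] ℝ) : ℝ :=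
  g.inner x (sharp g x σ) (sharp g x θ)

variable (Psi : M → ℝ)

/-- The Bakry-Émery tensor `Ricci(L) = Ricci_g + Hess Ψ` at `x`. -/
noncomputable def bakryEmery (x : M) (v w : TangentSpace (𝓡 n) x) : ℝ :=
  let e := chartAt (EuclideanSpace ℝ (Fin n)) x
  ∑ i, ∑ j, (ricciCoord (metricCoord g e) i j (e x) +
    hessCoord (metricCoord g e) (Psi ∘ e.symm) i j (e x)) * coframe x i v * coframe x j w

/-- The generator `L f = Δ f - ∇Ψ · ∇f` on functions. -/
noncomputable def gen (f : M → ℝ) (x : M) : ℝ :=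
  let e := chartAt (EuclideanSpace ℝ (Fin n)) x
  genCoord (metricCoord g e) (Psi ∘ e.symm) (f ∘ e.symm) (e x)

/-- The weighted divergence `δ_Ψ η` of a `1`-form. -/
noncomputable def divForm (η : ∀ x : M, TangentSpace (𝓡 n) x →L[ℝ] ℝ) (x : M) : ℝ :=
  let e := chartAt (EuclideanSpace ℝ (Fin n)) x
  divCoord (metricCoord g e) (Psi ∘ e.symm) (formCoord η e) (e x)

/-- The (modified) Hodge-de Rham operator `d δ_Ψ + δ_Ψ d` on `1`-forms. -/
noncomputable def hodge (η : ∀ x : M, TangentSpace (𝓡 n) x →L[ℝ] ℝ) (x : M) :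
    TangentSpace (𝓡 n) x →L[ℝ] ℝ :=
  let e := chartAt (EuclideanSpace ℝ (Fin n)) x
  ∑ i, hodgeCoord (metricCoord g e) (Psi ∘ e.symm) (formCoord η e) i (e x) • coframe x i

end Manifold

end WeightedRiem

open WeightedRiem

/-! The inequality is pointwise, so it is proved in one chart. The weighted Bochner formula gives
L|η|²/2 - η·(dδ_Ψ + δ_Ψ d)η = |∇η|² + Ricci(L)(η*, η*) (`IsMetricOn.bochner`). Since d|η|² = 2 η·∇η,
the two terms in b complete a square: |∇η|² + 2b α·d|η|² + 4b²|α|²|η|² = |∇η + 2b α⊗η|². The tensor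
T = ∇η + 2b α⊗η has trace s + q, where s = δ_Ψ η + 2b α·η and q = ∇Ψ·η, so Cauchy-Schwarz yields (s
+ q)²/n ≤ |T|² (`IsMetricOn.sq_trace_le`). The curvature hypothesis at η* supplies R|η|² + q²/(m -
n), and (s + q)²/n + q²/(m - n) ≥ s²/m (`sq_div_le_add_sq_div`).

The Bochner formula rests on the Weitzenböck formula `IsMetricOn.hodgeCoord_eq`, which commutes two
covariant derivatives (`IsMetricOn.ricci_identity`) and contracts the curvature into Ricci by its
skewness (`IsMetricOn.curvMatrix_skew`). -/

namespace WeightedRiem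

/-! ### Partial derivatives of smooth functions and matrices on an open set. -/

section Calculus

variable {n : ℕ} {U : Set (EuclideanSpace ℝ (Fin n))} {f h : EuclideanSpace ℝ (Fin n) → ℝ}
  {y : EuclideanSpace ℝ (Fin n)}

theorem differentiableAt_of_contDiffOn (hU : IsOpen U) (hf : ContDiffOn ℝ ∞ f U) (hy : y ∈ U) :
    DifferentiableAt ℝ f y :=
  (hf.contDiffAt (hU.mem_nhds hy)).differentiableAt (by simp)

theorem pd_add (i : Fin n) (hf : DifferentiableAt ℝ f y) (hh : DifferentiableAt ℝ h y) :
    pd i (fun z ↦ f z + h z) y = pd i f y + pd i h y := by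
  simp [pd, fderiv_fun_add hf hh]

theorem pd_sub (i : Fin n) (hf : DifferentiableAt ℝ f y) (hh : DifferentiableAt ℝ h y) :
    pd i (fun z ↦ f z - h z) y = pd i f y - pd i h y := by
  simp [pd, fderiv_fun_sub hf hh]

theorem pd_mul (i : Fin n) (hf : DifferentiableAt ℝ f y) (hh : DifferentiableAt ℝ h y) :
    pd i (fun z ↦ f z * h z) y = pd i f y * h y + f y * pd i h y := by
  simp [pd, fderiv_fun_mul hf hh]
  ring

theorem pd_neg (i : Fin n) : pd i (fun z ↦ -f z) y = -pd i f y := by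
  simp [pd, fderiv_fun_neg]

theorem pd_div_const (i : Fin n) (c : ℝ) (hf : DifferentiableAt ℝ f y) :
    pd i (fun z ↦ f z / c) y = pd i f y / c := by
  simp only [pd, div_eq_mul_inv]
  rw [fderiv_mul_const hf]
  simp [mul_comm]

theorem pd_sum {ι : Type*} (s : Finset ι) (i : Fin n) {F : ι → EuclideanSpace ℝ (Fin n) → ℝ}
    (hF : ∀ a ∈ s, DifferentiableAt ℝ (F a) y) :
    pd i (fun z ↦ ∑ a ∈ s, F a z) y = ∑ a ∈ s, pd i (F a) y := by
  simp [pd, fderiv_fun_sum hF]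

/-- Tensor identities are known only on the chart domain; openness is what allows them to be
differentiated. -/
theorem pd_congr (hU : IsOpen U) (hfh : ∀ z ∈ U, f z = h z) (hy : y ∈ U) (i : Fin n) :
    pd i f y = pd i h y := by
  have : f =ᶠ[nhds y] h := Filter.eventually_of_mem (hU.mem_nhds hy) hfh
  simp [pd, this.fderiv_eq]

theorem pd_const (i : Fin n) (c : ℝ) : pd i (fun _ ↦ c) y = 0 := by
  simp [pd]

theorem contDiffOn_pd (hU : IsOpen U) (hf : ContDiffOn ℝ ∞ f U) (i : Fin n) :
    ContDiffOn ℝ ∞ (pd i f) U :=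
  (hf.fderiv_of_isOpen hU (by simp)).clm_apply contDiffOn_const

theorem pd_comm (hU : IsOpen U) (hf : ContDiffOn ℝ ∞ f U) (hy : y ∈ U) (i j : Fin n) :
    pd i (pd j f) y = pd j (pd i f) y := by
  have hc := hf.contDiffAt (hU.mem_nhds hy)
  have hd : DifferentiableAt ℝ (fderiv ℝ f) y :=
    ((hf.fderiv_of_isOpen (m := ∞) hU (by simp)).contDiffAt (hU.mem_nhds hy)).differentiableAt
      (by simp)
  have key : ∀ v w : EuclideanSpace ℝ (Fin n),
      fderiv ℝ (fun z ↦ fderiv ℝ f z w) y v = fderiv ℝ (fderiv ℝ f) y v w := by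
    intro v w
    rw [fderiv_clm_apply hd (differentiableAt_const w)]
    simp
  have hs : IsSymmSndFDerivAt ℝ f y := hc.isSymmSndFDerivAt (by simpa using ENat.LEInfty.out)
  change fderiv ℝ (fun z ↦ fderiv ℝ f z _) y _ = fderiv ℝ (fun z ↦ fderiv ℝ f z _) y _
  rw [key, key]
  exact hs _ _

/-- The entrywise partial derivative of a matrix-valued function. -/
noncomputable def pdMatrix (k : Fin n) (A : EuclideanSpace ℝ (Fin n) → Matrix (Fin n) (Fin n) ℝ)
    (y : EuclideanSpace ℝ (Fin n)) : Matrix (Fin n) (Fin n) ℝ :=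
  Matrix.of fun i j ↦ pd k (fun z ↦ A z i j) y

/-- Entrywise smoothness of a matrix-valued function. -/
def SmoothMatrixOn (A : EuclideanSpace ℝ (Fin n) → Matrix (Fin n) (Fin n) ℝ)
    (U : Set (EuclideanSpace ℝ (Fin n))) : Prop :=
  ∀ i j, ContDiffOn ℝ ∞ (fun z ↦ A z i j) U

variable {A B : EuclideanSpace ℝ (Fin n) → Matrix (Fin n) (Fin n) ℝ}

theorem SmoothMatrixOn.mul (hA : SmoothMatrixOn A U) (hB : SmoothMatrixOn B U) :
    SmoothMatrixOn (fun z ↦ A z * B z) U := by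
  intro i j
  simp only [Matrix.mul_apply]
  exact ContDiffOn.sum fun k _ ↦ (hA i k).mul (hB k j)

theorem SmoothMatrixOn.add (hA : SmoothMatrixOn A U) (hB : SmoothMatrixOn B U) :
    SmoothMatrixOn (fun z ↦ A z + B z) U :=
  fun i j ↦ (hA i j).add (hB i j)

theorem SmoothMatrixOn.transpose (hA : SmoothMatrixOn A U) :
    SmoothMatrixOn (fun z ↦ (A z).transpose) U :=
  fun i j ↦ hA j i

theorem pdMatrix_mul (hU : IsOpen U) (hA : SmoothMatrixOn A U) (hB : SmoothMatrixOn B U)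
    (hy : y ∈ U) (k : Fin n) :
    pdMatrix k (fun z ↦ A z * B z) y = pdMatrix k A y * B y + A y * pdMatrix k B y := by
  have dA := fun i j ↦ differentiableAt_of_contDiffOn hU (hA i j) hy
  have dB := fun i j ↦ differentiableAt_of_contDiffOn hU (hB i j) hy
  ext i j
  simp only [pdMatrix, Matrix.mul_apply, Matrix.of_apply, Matrix.add_apply]
  rw [pd_sum _ _ fun a _ ↦ (dA i a).fun_mul (dB a j), ← Finset.sum_add_distrib]
  exact Finset.sum_congr rfl fun a _ ↦ pd_mul k (dA i a) (dB a j)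

theorem pdMatrix_add (hU : IsOpen U) (hA : SmoothMatrixOn A U) (hB : SmoothMatrixOn B U)
    (hy : y ∈ U) (k : Fin n) :
    pdMatrix k (fun z ↦ A z + B z) y = pdMatrix k A y + pdMatrix k B y := by
  ext i j
  exact pd_add k (differentiableAt_of_contDiffOn hU (hA i j) hy)
    (differentiableAt_of_contDiffOn hU (hB i j) hy)

theorem pdMatrix_neg (k : Fin n) : pdMatrix k (fun z ↦ -A z) y = -pdMatrix k A y := by
  ext i j
  exact pd_neg k

theorem pdMatrix_transpose (k : Fin n) :
    pdMatrix k (fun z ↦ (A z).transpose) y = (pdMatrix k A y).transpose := rfl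

theorem pdMatrix_congr (hU : IsOpen U) (hAB : ∀ z ∈ U, A z = B z) (hy : y ∈ U) (k : Fin n) :
    pdMatrix k A y = pdMatrix k B y := by
  ext i j
  exact pd_congr hU (fun z hz ↦ by rw [hAB z hz]) hy k

theorem pdMatrix_comm (hU : IsOpen U) (hA : SmoothMatrixOn A U) (hy : y ∈ U) (k l : Fin n) :
    pdMatrix k (pdMatrix l A) y = pdMatrix l (pdMatrix k A) y := by
  ext i j
  exact pd_comm hU (hA i j) hy k l

theorem contDiffOn_det (hA : SmoothMatrixOn A U) : ContDiffOn ℝ ∞ (fun z ↦ (A z).det) U := by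
  simp only [Matrix.det_apply]
  exact ContDiffOn.sum fun σ _ ↦ (contDiffOn_prod fun i _ ↦ hA _ _).const_smul _

/-- Cramer's rule: each entry is a quotient of determinants, the numerator's matrix being `A z` with
one row replaced by a constant one. -/
theorem SmoothMatrixOn.inv (hA : SmoothMatrixOn A U) (hdet : ∀ z ∈ U, (A z).det ≠ 0) :
    SmoothMatrixOn (fun z ↦ (A z)⁻¹) U := by
  intro i j
  simp only [Matrix.inv_def, Matrix.smul_apply, Ring.inverse_eq_inv', smul_eq_mul,
    Matrix.adjugate_apply]
  refine ((contDiffOn_det hA).inv hdet).mul (contDiffOn_det fun a b ↦ ?_)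
  by_cases h : a = j
  · subst h
    simpa using contDiffOn_const
  · simpa [Matrix.updateRow_apply, h] using hA a b

end Calculus

/-! ### Christoffel symbols, metric compatibility and curvature. -/

section Metric

variable {n : ℕ} {U : Set (EuclideanSpace ℝ (Fin n))}
  {G : EuclideanSpace ℝ (Fin n) → Matrix (Fin n) (Fin n) ℝ} {y : EuclideanSpace ℝ (Fin n)}

/-- `G` is the coefficient matrix of a smooth Riemannian metric on the open set `U`. -/
structure IsMetricOn (G : EuclideanSpace ℝ (Fin n) → Matrix (Fin n) (Fin n) ℝ)
    (U : Set (EuclideanSpace ℝ (Fin n))) : Prop where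
  isOpen : IsOpen U
  smooth : SmoothMatrixOn G U
  posDef : ∀ z ∈ U, (G z).PosDef

/-- The connection matrix `Γ_k`, with entries `Γ_{ki}^p` (row `p`, column `i`). -/
noncomputable def connMatrix (G : EuclideanSpace ℝ (Fin n) → Matrix (Fin n) (Fin n) ℝ)
    (k : Fin n) (z : EuclideanSpace ℝ (Fin n)) : Matrix (Fin n) (Fin n) ℝ :=
  Matrix.of fun p i ↦ christoffel G p k i z

/-- The curvature matrix `R_{kj} = ∂_k Γ_j - ∂_j Γ_k + [Γ_k, Γ_j]`. -/
noncomputable def curvMatrix (G : EuclideanSpace ℝ (Fin n) → Matrix (Fin n) (Fin n) ℝ)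
    (k j : Fin n) (z : EuclideanSpace ℝ (Fin n)) : Matrix (Fin n) (Fin n) ℝ :=
  pdMatrix k (connMatrix G j) z - pdMatrix j (connMatrix G k) z +
    (connMatrix G k z * connMatrix G j z - connMatrix G j z * connMatrix G k z)

namespace IsMetricOn

theorem symm (hG : IsMetricOn G U) (hy : y ∈ U) (i j : Fin n) : G y i j = G y j i := by
  simpa using ((hG.posDef y hy).isHermitian.apply i j).symm

theorem det_ne_zero (hG : IsMetricOn G U) (hy : y ∈ U) : (G y).det ≠ 0 :=
  (hG.posDef y hy).det_pos.ne'

theorem inv_mul (hG : IsMetricOn G U) (hy : y ∈ U) : (G y)⁻¹ * G y = 1 :=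
  Matrix.nonsing_inv_mul _ (isUnit_iff_ne_zero.2 (hG.det_ne_zero hy))

theorem mul_inv (hG : IsMetricOn G U) (hy : y ∈ U) : G y * (G y)⁻¹ = 1 :=
  Matrix.mul_nonsing_inv _ (isUnit_iff_ne_zero.2 (hG.det_ne_zero hy))

theorem inv_symm (hG : IsMetricOn G U) (hy : y ∈ U) (i j : Fin n) :
    (G y)⁻¹ i j = (G y)⁻¹ j i := by
  simpa using ((hG.posDef y hy).inv.isHermitian.apply i j).symm

theorem smooth_inv (hG : IsMetricOn G U) : SmoothMatrixOn (fun z ↦ (G z)⁻¹) U :=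
  hG.smooth.inv fun _ hz ↦ hG.det_ne_zero hz

theorem smooth_christoffel (hG : IsMetricOn G U) (p i j : Fin n) :
    ContDiffOn ℝ ∞ (christoffel G p i j) U := by
  refine contDiffOn_const.mul (ContDiffOn.sum fun l _ ↦ (hG.smooth_inv p l).mul ?_)
  exact ((contDiffOn_pd hG.isOpen (hG.smooth j l) i).add
    (contDiffOn_pd hG.isOpen (hG.smooth i l) j)).sub (contDiffOn_pd hG.isOpen (hG.smooth i j) l)

theorem smooth_connMatrix (hG : IsMetricOn G U) (k : Fin n) : SmoothMatrixOn (connMatrix G k) U :=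
  fun p i ↦ hG.smooth_christoffel p k i

theorem pd_symm (hG : IsMetricOn G U) (hy : y ∈ U) (k i j : Fin n) :
    pd k (fun z ↦ G z i j) y = pd k (fun z ↦ G z j i) y :=
  pd_congr hG.isOpen (fun _ hz ↦ hG.symm hz i j) hy k

theorem christoffel_symm (hG : IsMetricOn G U) (hy : y ∈ U) (p i j : Fin n) :
    christoffel G p i j y = christoffel G p j i y := by
  simp only [christoffel]
  congr 1
  refine Finset.sum_congr rfl fun l _ ↦ ?_
  rw [hG.pd_symm hy l i j]
  ring

/-- Lowering the index removes the inverse metric. In the sum of two such symbols giving ∂_k g_ij,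
the other derivatives of g cancel. -/
theorem sum_metric_mul_christoffel (hG : IsMetricOn G U) (hy : y ∈ U) (q i j : Fin n) :
    ∑ p, G y q p * christoffel G p i j y =
      (1 / 2) * (pd i (fun z ↦ G z j q) y + pd j (fun z ↦ G z i q) y
        - pd q (fun z ↦ G z i j) y) := by
  have h : ∀ l, ∑ p, G y q p * (G y)⁻¹ p l = if q = l then 1 else 0 := fun l ↦ by
    rw [← Matrix.mul_apply, hG.mul_inv hy, Matrix.one_apply]
  simp only [christoffel, Finset.mul_sum]
  rw [Finset.sum_comm]
  calc _ = ∑ l, (∑ p, G y q p * (G y)⁻¹ p l) * ((1 / 2) * (pd i (fun z ↦ G z j l) y +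
        pd j (fun z ↦ G z i l) y - pd l (fun z ↦ G z i j) y)) := by
        refine Finset.sum_congr rfl fun l _ ↦ ?_
        rw [Finset.sum_mul]
        exact Finset.sum_congr rfl fun p _ ↦ by ring
    _ = _ := by simp [h]

/-- The metric is parallel. -/
theorem pdMatrix_metric (hG : IsMetricOn G U) (hy : y ∈ U) (k : Fin n) :
    pdMatrix k G y = (connMatrix G k y).transpose * G y + G y * connMatrix G k y := by
  ext i j
  simp only [pdMatrix, Matrix.of_apply, Matrix.add_apply, Matrix.mul_apply, connMatrix,
    Matrix.transpose_apply]
  rw [hG.sum_metric_mul_christoffel hy]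
  have : ∑ p, christoffel G p k i y * G y p j = ∑ p, G y j p * christoffel G p k i y :=
    Finset.sum_congr rfl fun p _ ↦ by rw [hG.symm hy p j, mul_comm]
  rw [this, hG.sum_metric_mul_christoffel hy, hG.pd_symm hy k j i, hG.pd_symm hy i k j,
    hG.pd_symm hy j k i]
  ring

theorem pdMatrix_inv (hG : IsMetricOn G U) (hy : y ∈ U) (k : Fin n) :
    pdMatrix k (fun z ↦ (G z)⁻¹) y =
      -(connMatrix G k y * (G y)⁻¹ + (G y)⁻¹ * (connMatrix G k y).transpose) := by
  -- Differentiate G⁻¹G = 1, insert the formula for ∂_k G, then multiply by G⁻¹ on the right.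
  have h0 : pdMatrix k (fun z ↦ (G z)⁻¹ * G z) y = 0 := by
    rw [pdMatrix_congr hG.isOpen (B := fun _ ↦ 1) (fun z hz ↦ hG.inv_mul hz) hy]
    ext i j
    exact pd_const k _
  rw [pdMatrix_mul hG.isOpen hG.smooth_inv hG.smooth hy, hG.pdMatrix_metric hy] at h0
  set P := pdMatrix k (fun z ↦ (G z)⁻¹) y
  set H := (G y)⁻¹
  set C := connMatrix G k y
  have h1 : H * G y = 1 := hG.inv_mul hy
  have h2 : G y * H = 1 := hG.mul_inv hy
  have h3 : (P * G y + H * (C.transpose * G y + G y * C)) * H = 0 := by rw [h0, zero_mul]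
  have h4 : (P * G y + H * (C.transpose * G y + G y * C)) * H
      = P * (G y * H) + H * C.transpose * (G y * H) + (H * G y) * C * H := by noncomm_ring
  rw [h4, h1, h2] at h3
  simp only [mul_one, one_mul] at h3
  rw [eq_neg_iff_add_eq_zero, ← h3]
  abel

theorem pdMatrix_pdMatrix_inv (hG : IsMetricOn G U) (hy : y ∈ U) (j k : Fin n) :
    pdMatrix j (pdMatrix k fun z ↦ (G z)⁻¹) y =
      -(pdMatrix j (connMatrix G k) y * (G y)⁻¹
        - connMatrix G k y *
          (connMatrix G j y * (G y)⁻¹ + (G y)⁻¹ * (connMatrix G j y).transpose)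
        - (connMatrix G j y * (G y)⁻¹ + (G y)⁻¹ * (connMatrix G j y).transpose) *
          (connMatrix G k y).transpose
        + (G y)⁻¹ * (pdMatrix j (connMatrix G k) y).transpose) := by
  have hC := hG.smooth_connMatrix k
  have hH := hG.smooth_inv
  rw [pdMatrix_congr hG.isOpen (fun z hz ↦ hG.pdMatrix_inv hz k) hy j, pdMatrix_neg,
    pdMatrix_add hG.isOpen (hC.mul hH) (hH.mul hC.transpose) hy,
    pdMatrix_mul hG.isOpen hC hH hy, pdMatrix_mul hG.isOpen hH hC.transpose hy,
    hG.pdMatrix_inv hy j, pdMatrix_transpose]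
  noncomm_ring

/-- The curvature is skew-adjoint with respect to the metric. -/
theorem curvMatrix_skew (hG : IsMetricOn G U) (hy : y ∈ U) (k j : Fin n) :
    curvMatrix G k j y * (G y)⁻¹ = -((G y)⁻¹ * (curvMatrix G k j y).transpose) := by
  -- Once the first-order formula is inserted twice, the equality of the mixed second derivatives of
  -- G⁻¹ says exactly that R G⁻¹ + G⁻¹ Rᵀ = 0.
  have h := pdMatrix_comm hG.isOpen hG.smooth_inv hy j k
  rw [hG.pdMatrix_pdMatrix_inv hy, hG.pdMatrix_pdMatrix_inv hy] at h
  rw [curvMatrix]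
  simp only [Matrix.transpose_add, Matrix.transpose_sub, Matrix.transpose_mul]
  rw [← sub_eq_zero] at h ⊢
  rw [← h]
  noncomm_ring

theorem ricciCoord_eq (j i : Fin n) :
    ricciCoord G j i y = ∑ k, curvMatrix G k j y k i := by
  simp only [ricciCoord, curvMatrix, Matrix.add_apply, Matrix.sub_apply, Matrix.mul_apply,
    pdMatrix, connMatrix, Matrix.of_apply, Finset.sum_sub_distrib]

end IsMetricOn

end Metric

/-! ### Ricci identity, Weitzenböck and Bochner formulas. -/

section Bochner

variable {n : ℕ} {U : Set (EuclideanSpace ℝ (Fin n))}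
  {G : EuclideanSpace ℝ (Fin n) → Matrix (Fin n) (Fin n) ℝ} {y : EuclideanSpace ℝ (Fin n)}

/-- The scalar product `g^{ij} u_i v_j` of two covectors given by their components. -/
noncomputable def coordInner (G : EuclideanSpace ℝ (Fin n) → Matrix (Fin n) (Fin n) ℝ)
    (u v : Fin n → ℝ) (y : EuclideanSpace ℝ (Fin n)) : ℝ :=
  ∑ i, ∑ j, (G y)⁻¹ i j * u i * v j

theorem coordInner_add_right (u v w : Fin n → ℝ) :
    coordInner G u (fun i ↦ v i + w i) y = coordInner G u v y + coordInner G u w y := by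
  simp only [coordInner, mul_add, Finset.sum_add_distrib]

theorem coordInner_sub_right (u v w : Fin n → ℝ) :
    coordInner G u (fun i ↦ v i - w i) y = coordInner G u v y - coordInner G u w y := by
  simp only [coordInner, mul_sub, Finset.sum_sub_distrib]

theorem coordInner_smul_right (c : ℝ) (u v : Fin n → ℝ) :
    coordInner G u (fun i ↦ c * v i) y = c * coordInner G u v y := by
  simp only [coordInner, Finset.mul_sum]
  exact Finset.sum_congr rfl fun i _ ↦ Finset.sum_congr rfl fun j _ ↦ by ring

theorem coordInner_sum_right {ι : Type*} (s : Finset ι) (u : Fin n → ℝ) (v : ι → Fin n → ℝ) :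
    coordInner G u (fun i ↦ ∑ a ∈ s, v a i) y = ∑ a ∈ s, coordInner G u (v a) y := by
  simp only [coordInner, Finset.mul_sum]
  rw [Finset.sum_comm]
  rw [Finset.sum_congr rfl fun i _ ↦ Finset.sum_comm, Finset.sum_comm]
  conv_rhs => rw [Finset.sum_congr rfl fun i _ ↦ Finset.sum_comm]

namespace IsMetricOn

theorem coordInner_comm (hG : IsMetricOn G U) (hy : y ∈ U) (u v : Fin n → ℝ) :
    coordInner G u v y = coordInner G v u y := by
  simp only [coordInner]
  rw [Finset.sum_comm]
  exact Finset.sum_congr rfl fun i _ ↦ Finset.sum_congr rfl fun j _ ↦ by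
    rw [hG.inv_symm hy]; ring

theorem pd_inv (hG : IsMetricOn G U) (hy : y ∈ U) (k i j : Fin n) :
    pd k (fun z ↦ (G z)⁻¹ i j) y = -(∑ p, christoffel G i k p y * (G y)⁻¹ p j +
      ∑ p, (G y)⁻¹ i p * christoffel G j k p y) := by
  have h := congrFun₂ (hG.pdMatrix_inv hy k) i j
  simpa [pdMatrix, Matrix.mul_apply, connMatrix] using h

/-- Covariant differentiation commutes with the trace of a `2`-tensor. -/
theorem pd_trace (hG : IsMetricOn G U) (hy : y ∈ U)
    {T : Fin n → Fin n → EuclideanSpace ℝ (Fin n) → ℝ} (hT : ∀ i j, ContDiffOn ℝ ∞ (T i j) U)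
    (k : Fin n) :
    pd k (fun z ↦ ∑ i, ∑ j, (G z)⁻¹ i j * T i j z) y =
      ∑ i, ∑ j, (G y)⁻¹ i j * covDerivTwo G T k i j y := by
  have dH := fun i j ↦ differentiableAt_of_contDiffOn hG.isOpen (hG.smooth_inv i j) hy
  have dT := fun i j ↦ differentiableAt_of_contDiffOn hG.isOpen (hT i j) hy
  rw [pd_sum _ _ fun i _ ↦ DifferentiableAt.fun_sum fun j _ ↦ (dH i j).fun_mul (dT i j)]
  simp only [pd_sum _ _ fun j _ ↦ (dH _ j).fun_mul (dT _ j), pd_mul _ (dH _ _) (dT _ _),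
    hG.pd_inv hy, covDerivTwo, mul_sub, Finset.sum_add_distrib, Finset.sum_sub_distrib, neg_mul,
    add_mul, mul_add, Finset.sum_neg_distrib, neg_add, Finset.sum_mul, Finset.mul_sum]
  have e1 : ∑ i, ∑ j, ∑ p, christoffel G i k p y * (G y)⁻¹ p j * T i j y =
      ∑ i, ∑ j, ∑ p, (G y)⁻¹ i j * (christoffel G p k i y * T p j y) := by
    rw [Finset.sum_congr rfl fun i _ ↦ Finset.sum_comm, Finset.sum_comm]
    refine Finset.sum_congr rfl fun i _ ↦ ?_
    rw [Finset.sum_comm]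
    exact Finset.sum_congr rfl fun j _ ↦ Finset.sum_congr rfl fun p _ ↦ by ring
  have e2 : ∑ i, ∑ j, ∑ p, (G y)⁻¹ i p * christoffel G j k p y * T i j y =
      ∑ i, ∑ j, ∑ p, (G y)⁻¹ i j * (christoffel G p k j y * T i p y) := by
    refine Finset.sum_congr rfl fun i _ ↦ ?_
    rw [Finset.sum_comm]
    exact Finset.sum_congr rfl fun j _ ↦ Finset.sum_congr rfl fun p _ ↦ by ring
  rw [e1, e2]
  ring

theorem smooth_coordInner (hG : IsMetricOn G U) {u v : Fin n → EuclideanSpace ℝ (Fin n) → ℝ}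
    (hu : ∀ i, ContDiffOn ℝ ∞ (u i) U) (hv : ∀ i, ContDiffOn ℝ ∞ (v i) U) :
    ContDiffOn ℝ ∞ (fun z ↦ coordInner G (fun i ↦ u i z) (fun i ↦ v i z) z) U :=
  ContDiffOn.sum fun i _ ↦ ContDiffOn.sum fun j _ ↦ ((hG.smooth_inv i j).mul (hu i)).mul (hv j)

/-- The Levi-Civita connection is metric. -/
theorem pd_coordInner (hG : IsMetricOn G U) (hy : y ∈ U)
    {u v : Fin n → EuclideanSpace ℝ (Fin n) → ℝ} (hu : ∀ i, ContDiffOn ℝ ∞ (u i) U)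
    (hv : ∀ i, ContDiffOn ℝ ∞ (v i) U) (k : Fin n) :
    pd k (fun z ↦ coordInner G (fun i ↦ u i z) (fun i ↦ v i z) z) y =
      coordInner G (fun i ↦ covDeriv G u k i y) (fun i ↦ v i y) y +
      coordInner G (fun i ↦ u i y) (fun i ↦ covDeriv G v k i y) y := by
  have du := fun i ↦ differentiableAt_of_contDiffOn hG.isOpen (hu i) hy
  have dv := fun i ↦ differentiableAt_of_contDiffOn hG.isOpen (hv i) hy
  simp only [coordInner, mul_assoc]
  rw [hG.pd_trace hy (T := fun i j z ↦ u i z * v j z) fun i j ↦ (hu i).mul (hv j)]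
  simp only [← Finset.sum_add_distrib, ← mul_add]
  refine Finset.sum_congr rfl fun i _ ↦ Finset.sum_congr rfl fun j _ ↦ ?_
  congr 1
  simp only [covDerivTwo, covDeriv, pd_mul _ (du _) (dv _), Finset.sum_add_distrib, sub_mul,
    mul_sub, Finset.sum_mul, Finset.mul_sum, mul_assoc, mul_left_comm (u i y)]
  ring

theorem smooth_covDeriv (hG : IsMetricOn G U) {η : Fin n → EuclideanSpace ℝ (Fin n) → ℝ}
    (hη : ∀ i, ContDiffOn ℝ ∞ (η i) U) (i j : Fin n) :
    ContDiffOn ℝ ∞ (covDeriv G η i j) U :=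
  (contDiffOn_pd hG.isOpen (hη j) i).sub
    (ContDiffOn.sum fun p _ ↦ (hG.smooth_christoffel p i j).mul (hη p))

/-- With the first index frozen, `T i` can be differentiated as a 1-form. This alone is not
tensorial; the last sum is the correction for the frozen index. -/
theorem covDerivTwo_eq (T : Fin n → Fin n → EuclideanSpace ℝ (Fin n) → ℝ) (k i j : Fin n) :
    covDerivTwo G T k i j y = covDeriv G (T i) k j y - ∑ p, christoffel G p k i y * T p j y := by
  simp only [covDerivTwo, covDeriv, Finset.sum_add_distrib]
  ring

theorem covDerivTwo_sub (hG : IsMetricOn G U) (hy : y ∈ U)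
    {S T : Fin n → Fin n → EuclideanSpace ℝ (Fin n) → ℝ} (hS : ∀ i j, ContDiffOn ℝ ∞ (S i j) U)
    (hT : ∀ i j, ContDiffOn ℝ ∞ (T i j) U) (k i j : Fin n) :
    covDerivTwo G (fun a b z ↦ S a b z - T a b z) k i j y =
      covDerivTwo G S k i j y - covDerivTwo G T k i j y := by
  simp only [covDerivTwo, pd_sub _ (differentiableAt_of_contDiffOn hG.isOpen (hS _ _) hy)
    (differentiableAt_of_contDiffOn hG.isOpen (hT _ _) hy), mul_sub, Finset.sum_add_distrib,
    Finset.sum_sub_distrib]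
  ring

theorem covDerivTwo_swap (T : Fin n → Fin n → EuclideanSpace ℝ (Fin n) → ℝ) (k i j : Fin n) :
    covDerivTwo G (fun a b ↦ T b a) k i j y = covDerivTwo G T k j i y := by
  simp only [covDerivTwo, Finset.sum_add_distrib]
  ring

theorem covDerivTwo_tensor (hG : IsMetricOn G U) (hy : y ∈ U)
    {u v : Fin n → EuclideanSpace ℝ (Fin n) → ℝ} (hu : ∀ i, ContDiffOn ℝ ∞ (u i) U)
    (hv : ∀ i, ContDiffOn ℝ ∞ (v i) U) (k i j : Fin n) :
    covDerivTwo G (fun a b z ↦ u a z * v b z) k i j y =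
      covDeriv G u k i y * v j y + u i y * covDeriv G v k j y := by
  have du := fun i ↦ differentiableAt_of_contDiffOn hG.isOpen (hu i) hy
  have dv := fun i ↦ differentiableAt_of_contDiffOn hG.isOpen (hv i) hy
  simp only [covDerivTwo, covDeriv, pd_mul _ (du _) (dv _), Finset.sum_add_distrib, sub_mul,
    mul_sub, Finset.sum_mul, Finset.mul_sum, mul_assoc, mul_left_comm (u i y)]
  ring

theorem covDerivTwo_congr (hG : IsMetricOn G U) (hy : y ∈ U)
    {S T : Fin n → Fin n → EuclideanSpace ℝ (Fin n) → ℝ} (h : ∀ i j, ∀ z ∈ U, S i j z = T i j z)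
    (k i j : Fin n) : covDerivTwo G S k i j y = covDerivTwo G T k i j y := by
  simp only [covDerivTwo, pd_congr hG.isOpen (h i j) hy, h _ _ y hy]

theorem extDerivCoord_eq (hG : IsMetricOn G U) (hy : y ∈ U)
    (η : Fin n → EuclideanSpace ℝ (Fin n) → ℝ) (i j : Fin n) :
    extDerivCoord η i j y = covDeriv G η i j y - covDeriv G η j i y := by
  simp only [extDerivCoord, covDeriv, hG.christoffel_symm hy _ j i]
  ring

/-- The Ricci identity for `1`-forms. -/
theorem ricci_identity (hG : IsMetricOn G U) (hy : y ∈ U)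
    {η : Fin n → EuclideanSpace ℝ (Fin n) → ℝ} (hη : ∀ i, ContDiffOn ℝ ∞ (η i) U)
    (k j i : Fin n) :
    covDerivTwo G (covDeriv G η) j k i y - covDerivTwo G (covDeriv G η) k j i y =
      ∑ p, curvMatrix G k j y p i * η p y := by
  have dη := fun i ↦ differentiableAt_of_contDiffOn hG.isOpen (hη i) hy
  have dpη := fun i k ↦ differentiableAt_of_contDiffOn hG.isOpen
    (contDiffOn_pd hG.isOpen (hη i) k) hy
  have dC := fun p i j ↦ differentiableAt_of_contDiffOn hG.isOpen
    (hG.smooth_christoffel p i j) hy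
  -- The two sums with first derivatives of η exchange roles under j ↔ k, so they cancel on
  -- antisymmetrizing. The frozen-index correction cancels too, by the symmetry of Γ in its lower
  -- indices. Only curvature remains.
  have key : ∀ k j, covDeriv G (covDeriv G η k) j i y = pd j (pd k (η i)) y
      - ∑ p, (pd j (christoffel G p k i) y * η p y + christoffel G p k i y * pd j (η p) y)
      - ∑ p, christoffel G p j i y * pd k (η p) y
      + ∑ q, (∑ p, christoffel G q k p y * christoffel G p j i y) * η q y := by
    intro k j
    have h1 : pd j (covDeriv G η k i) y = pd j (pd k (η i)) y
        - ∑ p, (pd j (christoffel G p k i) y * η p y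
          + christoffel G p k i y * pd j (η p) y) := by
      change pd j (fun z ↦ pd k (η i) z - ∑ p, christoffel G p k i z * η p z) y = _
      rw [pd_sub _ (dpη i k) (DifferentiableAt.fun_sum fun p _ ↦ (dC p k i).fun_mul (dη p)),
        pd_sum _ _ fun p _ ↦ (dC p k i).fun_mul (dη p)]
      simp only [pd_mul _ (dC _ _ _) (dη _)]
    have h2 : ∑ p, christoffel G p j i y * covDeriv G η k p y =
        ∑ p, christoffel G p j i y * pd k (η p) y
        - ∑ q, (∑ p, christoffel G q k p y * christoffel G p j i y) * η q y := by
      simp only [covDeriv, mul_sub, Finset.sum_sub_distrib, Finset.mul_sum, Finset.sum_mul]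
      congr 1
      rw [Finset.sum_comm]
      exact Finset.sum_congr rfl fun _ _ ↦ Finset.sum_congr rfl fun _ _ ↦ by ring
    rw [covDeriv, h1, h2]
    ring
  rw [covDerivTwo_eq, covDerivTwo_eq, key, key, pd_comm hG.isOpen (hη i) hy j k]
  simp only [hG.christoffel_symm hy _ j k, curvMatrix, pdMatrix, connMatrix, Matrix.add_apply,
    Matrix.sub_apply, Matrix.mul_apply, Matrix.of_apply, add_mul, sub_mul,
    Finset.sum_add_distrib, Finset.sum_sub_distrib]
  ring

/-- The contracted Ricci identity. -/
theorem trace_ricci_identity (hG : IsMetricOn G U) (hy : y ∈ U)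
    {η : Fin n → EuclideanSpace ℝ (Fin n) → ℝ} (hη : ∀ i, ContDiffOn ℝ ∞ (η i) U)
    (j : Fin n) :
    ∑ k, ∑ i, (G y)⁻¹ k i * (covDerivTwo G (covDeriv G η) j k i y
        - covDerivTwo G (covDeriv G η) k j i y) =
      -∑ i, ∑ p, (G y)⁻¹ i p * ricciCoord G j i y * η p y := by
  -- Skewness read in row k of R_{kj}: it moves the contraction onto the upper index, where the sum
  -- over k is a Ricci trace.
  have hskew : ∀ k p, ∑ i, (G y)⁻¹ k i * curvMatrix G k j y p i =
      -∑ i, curvMatrix G k j y k i * (G y)⁻¹ i p := by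
    intro k p
    have h := congrFun₂ (hG.curvMatrix_skew hy k j) k p
    simp only [Matrix.mul_apply, Matrix.neg_apply, Matrix.transpose_apply] at h
    rw [h, neg_neg]
  calc _ = ∑ k, ∑ p, (∑ i, (G y)⁻¹ k i * curvMatrix G k j y p i) * η p y := by
        refine Finset.sum_congr rfl fun k _ ↦ ?_
        simp only [hG.ricci_identity hy hη, Finset.mul_sum, Finset.sum_mul]
        rw [Finset.sum_comm]
        exact Finset.sum_congr rfl fun _ _ ↦ Finset.sum_congr rfl fun _ _ ↦ by ring
    _ = -∑ k, ∑ p, ∑ i, curvMatrix G k j y k i * (G y)⁻¹ i p * η p y := by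
        simp only [hskew, neg_mul, Finset.sum_neg_distrib, Finset.sum_mul]
    _ = _ := by
        congr 1
        simp only [ricciCoord_eq, Finset.mul_sum, Finset.sum_mul]
        rw [Finset.sum_comm, Finset.sum_congr rfl fun p _ ↦ Finset.sum_comm, Finset.sum_comm]
        exact Finset.sum_congr rfl fun _ _ ↦ Finset.sum_congr rfl fun _ _ ↦
          Finset.sum_congr rfl fun _ _ ↦ by ring

/-- The Weitzenböck formula. -/
theorem hodgeCoord_eq (hG : IsMetricOn G U) (hy : y ∈ U) {psi : EuclideanSpace ℝ (Fin n) → ℝ}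
    (hpsi : ContDiffOn ℝ ∞ psi U)
    {η : Fin n → EuclideanSpace ℝ (Fin n) → ℝ} (hη : ∀ i, ContDiffOn ℝ ∞ (η i) U) (j : Fin n) :
    hodgeCoord G psi η j y =
      ∑ k, ∑ i, (G y)⁻¹ k i * (covDerivTwo G (covDeriv G η) k i j y
        - pd k psi y * covDeriv G η i j y)
      - ∑ i, ∑ p, (G y)⁻¹ i p * (ricciCoord G j i y + hessCoord G psi j i y) * η p y := by
  have sη := hG.smooth_covDeriv hη
  have spsi := contDiffOn_pd hG.isOpen hpsi
  have h1 : pd j (divCoord G psi η) y = ∑ k, ∑ i, (G y)⁻¹ k i *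
      (covDerivTwo G (covDeriv G η) j k i y - (hessCoord G psi j k y * η i y
        + pd k psi y * covDeriv G η j i y)) := by
    have := hG.pd_trace hy (T := fun k i z ↦ covDeriv G η k i z - pd k psi z * η i z)
      (fun k i ↦ (sη k i).sub ((spsi k).mul (hη i))) j
    refine this.trans (Finset.sum_congr rfl fun k _ ↦ Finset.sum_congr rfl fun i _ ↦ ?_)
    rw [hG.covDerivTwo_sub hy (S := covDeriv G η) (T := fun k i z ↦ pd k psi z * η i z) sη
      (fun k i ↦ (spsi k).mul (hη i)),
      hG.covDerivTwo_tensor hy (u := fun k ↦ pd k psi) spsi hη]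
    rfl
  have h2 : ∀ k i, covDerivTwo G (extDerivCoord η) k i j y =
      covDerivTwo G (covDeriv G η) k i j y - covDerivTwo G (covDeriv G η) k j i y := by
    intro k i
    rw [hG.covDerivTwo_congr hy (T := fun i j z ↦ covDeriv G η i j z - covDeriv G η j i z)
      (fun i j z hz ↦ hG.extDerivCoord_eq hz η i j),
      hG.covDerivTwo_sub hy (S := covDeriv G η) (T := fun i j ↦ covDeriv G η j i) sη
        (fun i j ↦ sη j i), covDerivTwo_swap (covDeriv G η)]
  -- The term ∇_k∇_j η_i from δ_Ψ d meets ∇_j∇_k η_i from d δ_Ψ, and their trace is the Ricci term.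
  -- The terms ∂_kΨ ∇_j η_i cancel, and differentiating ∂Ψ leaves the Hessian.
  have h3 := hG.trace_ricci_identity hy hη j
  rw [hodgeCoord, h1, divTwoCoord]
  simp only [h2, hG.extDerivCoord_eq hy]
  simp only [mul_sub, mul_add, add_mul, Finset.sum_add_distrib, Finset.sum_sub_distrib] at h3 ⊢
  simp only [mul_assoc] at h3 ⊢
  linarith

/-- The Bochner formula. -/
theorem bochner (hG : IsMetricOn G U) (hy : y ∈ U) {psi : EuclideanSpace ℝ (Fin n) → ℝ}
    (hpsi : ContDiffOn ℝ ∞ psi U)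
    {η : Fin n → EuclideanSpace ℝ (Fin n) → ℝ} (hη : ∀ i, ContDiffOn ℝ ∞ (η i) U) :
    genCoord G psi (fun z ↦ coordInner G (fun i ↦ η i z) (fun i ↦ η i z) z / 2) y
      - coordInner G (fun i ↦ η i y) (fun i ↦ hodgeCoord G psi η i y) y =
    ∑ k, ∑ l, (G y)⁻¹ k l *
        coordInner G (fun i ↦ covDeriv G η k i y) (fun i ↦ covDeriv G η l i y) y
      + coordInner G (fun i ↦ η i y) (fun j ↦ ∑ i, ∑ p, (G y)⁻¹ i p *
          (ricciCoord G j i y + hessCoord G psi j i y) * η p y) y := by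
  have sη := hG.smooth_covDeriv hη
  set f : EuclideanSpace ℝ (Fin n) → ℝ :=
    fun z ↦ coordInner G (fun i ↦ η i z) (fun i ↦ η i z) z / 2 with hf
  have h1 : ∀ k, ∀ z ∈ U, pd k f z =
      coordInner G (fun i ↦ η i z) (fun i ↦ covDeriv G η k i z) z := by
    intro k z hz
    rw [hf, pd_div_const _ _ (differentiableAt_of_contDiffOn hG.isOpen (hG.smooth_coordInner hη hη) hz),
      hG.pd_coordInner hz hη hη, hG.coordInner_comm hz (fun i ↦ covDeriv G η k i z)]
    ring
  -- Leibniz rule applied to ∂_k f = η·∇_k η; the Christoffel term of the Hessian is the correction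
  -- that turns the frozen-index derivative into ∇_l∇_k η.
  have h2 : ∀ l k, hessCoord G f l k y =
      coordInner G (fun i ↦ covDeriv G η l i y) (fun i ↦ covDeriv G η k i y) y +
      coordInner G (fun i ↦ η i y) (fun i ↦ covDerivTwo G (covDeriv G η) l k i y) y := by
    intro l k
    rw [hessCoord, covDeriv, pd_congr hG.isOpen (h1 k) hy,
      hG.pd_coordInner hy hη (sη k)]
    simp only [h1 _ y hy, covDerivTwo_eq, coordInner_sub_right, coordInner_sum_right,
      coordInner_smul_right]
    ring
  have h3 : coordInner G (fun i ↦ η i y) (fun j ↦ ∑ k, ∑ i, (G y)⁻¹ k i *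
      (covDerivTwo G (covDeriv G η) k i j y - pd k psi y * covDeriv G η i j y)) y =
      ∑ k, ∑ i, (G y)⁻¹ k i *
        (coordInner G (fun i ↦ η i y) (fun j ↦ covDerivTwo G (covDeriv G η) k i j y) y -
        pd k psi y * coordInner G (fun i ↦ η i y) (fun j ↦ covDeriv G η i j y) y) := by
    simp only [coordInner_sum_right, coordInner_smul_right, coordInner_sub_right]
  simp only [hG.hodgeCoord_eq hy hpsi hη]
  rw [coordInner_sub_right, h3, genCoord]
  simp only [h2, h1 _ y hy, mul_sub, mul_add, Finset.sum_add_distrib, Finset.sum_sub_distrib,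
    mul_assoc]
  ring

end IsMetricOn

end Bochner

/-! ### Cauchy-Schwarz for the trace and the completed square. -/

section Estimate

variable {n : ℕ} {U : Set (EuclideanSpace ℝ (Fin n))}
  {G : EuclideanSpace ℝ (Fin n) → Matrix (Fin n) (Fin n) ℝ} {y : EuclideanSpace ℝ (Fin n)}

-- Writing H = BᵀB and S = B T Bᵀ reduces to the Euclidean metric: (tr S)² ≤ n Σ S_aa² ≤ n Σ S_ab².
-- No symmetry of T is needed.
open Matrix MatrixOrder in
theorem sq_trace_mul_le {H : Matrix (Fin n) (Fin n) ℝ} (hH : H.PosSemidef)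
    (T : Matrix (Fin n) (Fin n) ℝ) : (H * T).trace ^ 2 ≤ n * (H * T * (H * Tᵀ)).trace := by
  obtain ⟨B, rfl⟩ := CStarAlgebra.nonneg_iff_eq_star_mul_self.mp hH.nonneg
  simp only [Matrix.star_eq_conjTranspose, Matrix.conjTranspose_eq_transpose_of_trivial]
  set S := B * T * Bᵀ with hS
  have h1 : (Bᵀ * B * T).trace = ∑ a, S a a := by
    rw [Matrix.mul_assoc, Matrix.trace_mul_comm, ← hS]
    rfl
  have h2 : (Bᵀ * B * T * (Bᵀ * B * Tᵀ)).trace = ∑ a, ∑ b, S a b ^ 2 := by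
    have : Bᵀ * B * T * (Bᵀ * B * Tᵀ) = Bᵀ * (S * (B * Tᵀ)) := by
      simp only [hS, Matrix.mul_assoc]
    rw [this, Matrix.trace_mul_comm]
    have : S * (B * Tᵀ) * Bᵀ = S * Sᵀ := by
      simp only [hS, Matrix.mul_assoc, Matrix.transpose_mul, Matrix.transpose_transpose]
    rw [this]
    simp [Matrix.trace, Matrix.mul_apply, sq]
  rw [h1, h2]
  calc (∑ a, S a a) ^ 2 ≤ (Finset.univ : Finset (Fin n)).card * ∑ a, S a a ^ 2 :=
        sq_sum_le_card_mul_sum_sq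
    _ ≤ _ := by
        rw [Finset.card_univ, Fintype.card_fin]
        refine mul_le_mul_of_nonneg_left (Finset.sum_le_sum fun a _ ↦ ?_) n.cast_nonneg
        exact Finset.single_le_sum (f := fun b ↦ S a b ^ 2) (fun b _ ↦ sq_nonneg _)
          (Finset.mem_univ a)

/-- The squared norm `g^{kl} g^{ij} S_{ki} T_{lj}`, polarized, of covariant `2`-tensors. -/
noncomputable def coordInnerTwo (G : EuclideanSpace ℝ (Fin n) → Matrix (Fin n) (Fin n) ℝ)
    (S T : Fin n → Fin n → ℝ) (y : EuclideanSpace ℝ (Fin n)) : ℝ :=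
  ∑ k, ∑ l, (G y)⁻¹ k l * coordInner G (S k) (T l) y

theorem IsMetricOn.sq_trace_le (hG : IsMetricOn G U) (hy : y ∈ U) (T : Fin n → Fin n → ℝ) :
    (∑ k, ∑ i, (G y)⁻¹ k i * T k i) ^ 2 ≤ n * coordInnerTwo G T T y := by
  have h := sq_trace_mul_le (hG.posDef y hy).inv.posSemidef (Matrix.of T)
  have h1 : ((G y)⁻¹ * Matrix.of T).trace = ∑ k, ∑ i, (G y)⁻¹ k i * T k i := by
    simp only [Matrix.trace, Matrix.diag_apply, Matrix.mul_apply, Matrix.of_apply]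
    rw [Finset.sum_comm]
    exact Finset.sum_congr rfl fun k _ ↦ Finset.sum_congr rfl fun i _ ↦ by rw [hG.inv_symm hy]
  have h2 : ((G y)⁻¹ * Matrix.of T * ((G y)⁻¹ * (Matrix.of T).transpose)).trace =
      coordInnerTwo G T T y := by
    simp only [Matrix.trace, Matrix.diag_apply, Matrix.mul_apply, Matrix.of_apply,
      Matrix.transpose_apply, coordInnerTwo, coordInner, Finset.sum_mul, Finset.mul_sum]
    refine Finset.sum_congr rfl fun k _ ↦ ?_
    rw [Finset.sum_congr rfl fun _ _ ↦ Finset.sum_comm, Finset.sum_comm]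
    conv_rhs => rw [Finset.sum_congr rfl fun _ _ ↦ Finset.sum_comm]
    conv_rhs => rw [Finset.sum_comm]
    conv_lhs => rw [Finset.sum_comm]
    refine Finset.sum_congr rfl fun i _ ↦ ?_
    exact Finset.sum_congr rfl fun _ _ ↦ Finset.sum_congr rfl fun _ _ ↦ by
      rw [hG.inv_symm hy i]; ring
  rwa [h1, h2] at h

theorem IsMetricOn.coordInnerTwo_add_tensor (hG : IsMetricOn G U) (hy : y ∈ U)
    (T : Fin n → Fin n → ℝ) (u v : Fin n → ℝ) :
    coordInnerTwo G (fun i j ↦ T i j + u i * v j) (fun i j ↦ T i j + u i * v j) y =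
      coordInnerTwo G T T y
        + 2 * coordInner G u (fun k ↦ coordInner G v (T k) y) y
        + coordInner G u u y * coordInner G v v y := by
  have hkl : ∀ k l, coordInner G (fun j ↦ T k j + u k * v j) (fun j ↦ T l j + u l * v j) y =
      coordInner G (T k) (T l) y + u l * coordInner G v (T k) y
        + u k * coordInner G v (T l) y + u k * u l * coordInner G v v y := by
    intro k l
    rw [coordInner_add_right, coordInner_smul_right, hG.coordInner_comm hy _ (T l),
      hG.coordInner_comm hy _ v]
    simp only [coordInner_add_right, coordInner_smul_right]
    rw [hG.coordInner_comm hy (T l), hG.coordInner_comm hy (T l)]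
    ring
  have hswap : coordInner G u (fun k ↦ coordInner G v (T k) y) y =
      ∑ k, ∑ l, (G y)⁻¹ k l * (u l * coordInner G v (T k) y) := by
    rw [hG.coordInner_comm hy, coordInner]
    exact Finset.sum_congr rfl fun _ _ ↦ Finset.sum_congr rfl fun _ _ ↦ by ring
  rw [two_mul]
  nth_rewrite 1 [hswap]
  simp only [coordInnerTwo, hkl, mul_add, Finset.sum_add_distrib]
  have h1 : coordInner G u (fun k ↦ coordInner G v (T k) y) y =
      ∑ k, ∑ l, (G y)⁻¹ k l * (u k * coordInner G v (T l) y) := by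
    simp only [coordInner, mul_assoc]
  have h2 : coordInner G u u y * coordInner G v v y =
      ∑ k, ∑ l, (G y)⁻¹ k l * (u k * u l * coordInner G v v y) := by
    rw [coordInner, Finset.sum_mul]
    simp only [Finset.sum_mul, mul_assoc]
  rw [h1, h2]
  ring

/-- As s = (s + q) - q and m = n + (m - n), this is weighted Cauchy-Schwarz. The degenerate cases m
= n and n = 0 are separate; there division by zero gives 0, so m = n needs q = 0. -/
theorem sq_div_le_add_sq_div {n : ℕ} {m s q N : ℝ} (hm : (n : ℝ) ≤ m) (hmn : m = n → q = 0)
    (hN : (s + q) ^ 2 ≤ n * N) (hN0 : 0 ≤ N) :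
    1 / m * s ^ 2 ≤ N + 1 / (m - n) * q ^ 2 := by
  have hn : (0 : ℝ) ≤ n := n.cast_nonneg
  rcases eq_or_lt_of_le hm with h | h
  · subst h
    obtain rfl := hmn rfl
    rcases eq_or_lt_of_le hn with h0 | h0
    · simp [← h0, hN0]
    · rw [div_mul_eq_mul_div, one_mul, div_le_iff₀ h0]
      simp only [add_zero] at hN
      simp
      linarith
  · have hd : 0 < m - n := sub_pos.2 h
    have hm0 : 0 < m := hn.trans_lt h
    rw [div_mul_eq_mul_div, one_mul, div_mul_eq_mul_div, one_mul, div_le_iff₀ hm0]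
    rcases eq_or_lt_of_le hn with h0 | h0
    · rw [← h0, zero_mul] at hN
      have hs : s = -q := by nlinarith [sq_nonneg (s + q)]
      rw [← h0, sub_zero, add_mul, div_mul_cancel₀ _ hm0.ne', hs]
      nlinarith [mul_nonneg hN0 hm0.le]
    · have hNn : (s + q) ^ 2 / n ≤ N := by rw [div_le_iff₀ h0]; linarith
      refine le_trans ?_ (mul_le_mul_of_nonneg_right (add_le_add_left hNn _) hm0.le)
      rw [← sub_nonneg]
      -- The Cauchy-Schwarz defect written as an explicit square.
      have : ((s + q) ^ 2 / n + q ^ 2 / (m - n)) * m - s ^ 2 =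
          ((m - n) * (s + q) + n * q) ^ 2 / (n * (m - n)) := by
        field_simp
        ring
      rw [this]
      positivity

/-- The coordinate form of the curvature-dimension inequality. -/
theorem IsMetricOn.bochner_le (hG : IsMetricOn G U) (hy : y ∈ U)
    {psi : EuclideanSpace ℝ (Fin n) → ℝ} (hpsi : ContDiffOn ℝ ∞ psi U)
    {η : Fin n → EuclideanSpace ℝ (Fin n) → ℝ} (hη : ∀ i, ContDiffOn ℝ ∞ (η i) U)
    (α : Fin n → ℝ) (R m b : ℝ) (hm : (n : ℝ) ≤ m) (hmn : m = n → ∀ i, pd i psi y = 0)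
    (hcurv : R * coordInner G (fun i ↦ η i y) (fun i ↦ η i y) y
        + 1 / (m - n) * coordInner G (fun i ↦ pd i psi y) (fun i ↦ η i y) y ^ 2 ≤
      coordInner G (fun i ↦ η i y) (fun j ↦ ∑ i, ∑ p, (G y)⁻¹ i p *
          (ricciCoord G j i y + hessCoord G psi j i y) * η p y) y) :
    1 / m * (divCoord G psi η y + 2 * b * coordInner G α (fun i ↦ η i y) y) ^ 2
        + R * coordInner G (fun i ↦ η i y) (fun i ↦ η i y) y ≤
      genCoord G psi (fun z ↦ coordInner G (fun i ↦ η i z) (fun i ↦ η i z) z / 2) y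
        - coordInner G (fun i ↦ η i y) (fun i ↦ hodgeCoord G psi η i y) y
        + 2 * b * coordInner G α
          (fun k ↦ pd k (fun z ↦ coordInner G (fun i ↦ η i z) (fun i ↦ η i z) z) y) y
        + 4 * b ^ 2 * coordInner G α α y
          * coordInner G (fun i ↦ η i y) (fun i ↦ η i y) y := by
  rw [hG.bochner hy hpsi hη]
  have hgrad : ∀ k, pd k (fun z ↦ coordInner G (fun i ↦ η i z) (fun i ↦ η i z) z) y =
      2 * coordInner G (fun i ↦ η i y) (fun i ↦ covDeriv G η k i y) y := fun k ↦ by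
    rw [hG.pd_coordInner hy hη hη, hG.coordInner_comm hy (fun i ↦ covDeriv G η k i y)]
    ring
  simp only [hgrad, coordInner_smul_right]
  -- The choice u = 2bα, v = η makes the cross term equal to 2b α·d|η|², because d|η|² = 2 η·∇η.
  have hS := hG.coordInnerTwo_add_tensor hy (fun k i ↦ covDeriv G η k i y) (fun k ↦ 2 * b * α k)
    fun i ↦ η i y
  have hT := hG.sq_trace_le hy fun k i ↦ covDeriv G η k i y + 2 * b * α k * η i y
  set N := coordInnerTwo G (fun k i ↦ covDeriv G η k i y + 2 * b * α k * η i y)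
    (fun k i ↦ covDeriv G η k i y + 2 * b * α k * η i y) y
  have htr : ∑ k, ∑ i, (G y)⁻¹ k i * (covDeriv G η k i y + 2 * b * α k * η i y) =
      (divCoord G psi η y + 2 * b * coordInner G α (fun i ↦ η i y) y)
        + coordInner G (fun i ↦ pd i psi y) (fun i ↦ η i y) y := by
    simp only [divCoord, coordInner, Finset.mul_sum, ← Finset.sum_add_distrib]
    exact Finset.sum_congr rfl fun _ _ ↦ Finset.sum_congr rfl fun _ _ ↦ by ring
  rw [htr] at hT
  -- For n > 0 this follows from the trace bound itself; for n = 0 the sum is empty.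
  have hN0 : 0 ≤ N := by
    rcases n.eq_zero_or_pos with h0 | h0
    · subst h0
      simp [N, coordInnerTwo]
    · have h0' : (0 : ℝ) < n := Nat.cast_pos.2 h0
      exact nonneg_of_mul_nonneg_right ((sq_nonneg _).trans hT) h0'
  have hq : m = n → coordInner G (fun i ↦ pd i psi y) (fun i ↦ η i y) y = 0 := fun h ↦ by
    simp [coordInner, hmn h]
  have hfin := sq_div_le_add_sq_div hm hq hT hN0
  have hα : coordInner G (fun k ↦ 2 * b * α k) (fun k ↦ 2 * b * α k) y =
      4 * b ^ 2 * coordInner G α α y := by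
    rw [coordInner_smul_right, hG.coordInner_comm hy, coordInner_smul_right]
    ring
  have hα' : coordInner G (fun k ↦ 2 * b * α k) (fun k ↦ coordInner G (fun i ↦ η i y)
      (fun i ↦ covDeriv G η k i y) y) y = 2 * b * coordInner G α (fun k ↦ coordInner G
      (fun i ↦ η i y) (fun i ↦ covDeriv G η k i y) y) y := by
    rw [hG.coordInner_comm hy, coordInner_smul_right, hG.coordInner_comm hy]
  rw [hα, hα'] at hS
  change N = ∑ k, ∑ l, (G y)⁻¹ k l *
    coordInner G (fun i ↦ covDeriv G η k i y) (fun i ↦ covDeriv G η l i y) y + _ + _ at hS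
  linarith

end Estimate

/-! ### Passing between intrinsic objects and chart components. -/

section Charts

variable {n : ℕ} {M : Type*} [TopologicalSpace M] [ChartedSpace (EuclideanSpace ℝ (Fin n)) M]
  [IsManifold (𝓡 n) ∞ M]
  {e : OpenPartialHomeomorph M (EuclideanSpace ℝ (Fin n))} {y : EuclideanSpace ℝ (Fin n)}

omit [IsManifold (𝓡 n) ∞ M] in
theorem frame_sum (c : Fin n → ℝ) :
    ∑ i, c i • frame e y i =
      mfderiv 𝓘(ℝ, EuclideanSpace ℝ (Fin n)) (𝓡 n) e.symm y
        (WithLp.toLp 2 c : EuclideanSpace ℝ (Fin n)) := by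
  have h : (WithLp.toLp 2 c : EuclideanSpace ℝ (Fin n)) =
      ∑ i, c i • EuclideanSpace.single i (1 : ℝ) := by
    ext j
    simp [Finset.sum_apply, Pi.single_apply]
  have := map_sum (mfderiv 𝓘(ℝ, EuclideanSpace ℝ (Fin n)) (𝓡 n) e.symm y)
    (fun i ↦ (c i • EuclideanSpace.single i (1 : ℝ) : EuclideanSpace ℝ (Fin n))) Finset.univ
  rw [h]
  refine Eq.trans ?_ this.symm
  exact Finset.sum_congr rfl fun i _ ↦ (ContinuousLinearMap.map_smul _ (c i) _).symm

theorem mfderiv_chart_mfderiv_symm (he : e ∈ atlas (EuclideanSpace ℝ (Fin n)) M)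
    (hy : y ∈ e.target) (v : EuclideanSpace ℝ (Fin n)) :
    mfderiv (𝓡 n) 𝓘(ℝ, EuclideanSpace ℝ (Fin n)) e (e.symm y)
      (mfderiv 𝓘(ℝ, EuclideanSpace ℝ (Fin n)) (𝓡 n) e.symm y v) = v :=
  DFunLike.congr_fun ((mdifferentiable_of_mem_atlas (I := 𝓡 n) he).comp_symm_deriv hy) v

theorem mfderiv_symm_mfderiv_chart (he : e ∈ atlas (EuclideanSpace ℝ (Fin n)) M)
    (hy : y ∈ e.target)
    (w : TangentSpace (𝓡 n) (e.symm y)) :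
    mfderiv 𝓘(ℝ, EuclideanSpace ℝ (Fin n)) (𝓡 n) e.symm y
      (mfderiv (𝓡 n) 𝓘(ℝ, EuclideanSpace ℝ (Fin n)) e (e.symm y) w) = w := by
  have h := (mdifferentiable_of_mem_atlas (I := 𝓡 n) he).symm_comp_deriv
    (e.map_target hy)
  rw [e.right_inv hy] at h
  exact DFunLike.congr_fun h w

theorem exists_frame_sum (he : e ∈ atlas (EuclideanSpace ℝ (Fin n)) M)
    (hy : y ∈ e.target)
    (w : TangentSpace (𝓡 n) (e.symm y)) :
    ∃ c : Fin n → ℝ, w = ∑ i, c i • frame e y i := by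
  let v : EuclideanSpace ℝ (Fin n) := mfderiv (𝓡 n) 𝓘(ℝ, EuclideanSpace ℝ (Fin n)) e (e.symm y) w
  refine ⟨fun i ↦ v i, ?_⟩
  rw [frame_sum]
  exact (mfderiv_symm_mfderiv_chart he hy w).symm

theorem frame_sum_ne_zero (he : e ∈ atlas (EuclideanSpace ℝ (Fin n)) M)
    (hy : y ∈ e.target) {c : Fin n → ℝ} (hc : c ≠ 0) :
    ∑ i, c i • frame e y i ≠ 0 := by
  intro h
  rw [frame_sum] at h
  have h2 := mfderiv_chart_mfderiv_symm he hy (WithLp.toLp 2 c)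
  rw [h] at h2
  apply hc
  have h3 : (WithLp.toLp 2 c : EuclideanSpace ℝ (Fin n)) = 0 :=
    h2.symm.trans (ContinuousLinearMap.map_zero (mfderiv (𝓡 n) 𝓘(ℝ, EuclideanSpace ℝ (Fin n)) e
      (e.symm y)))
  ext i
  exact congrArg (fun v : EuclideanSpace ℝ (Fin n) ↦ v i) h3

theorem mvfderiv_chart_frame (he : e ∈ atlas (EuclideanSpace ℝ (Fin n)) M)
    (hy : y ∈ e.target) (i j : Fin n) :
    (mvfderiv (𝓡 n) e (e.symm y) (frame e y j) : EuclideanSpace ℝ (Fin n)) i =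
      if i = j then 1 else 0 := by
  have h := mfderiv_chart_mfderiv_symm he hy (EuclideanSpace.single j (1 : ℝ))
  have h2 : mvfderiv (𝓡 n) e (e.symm y) (frame e y j)
      = EuclideanSpace.single j (1 : ℝ) := h
  rw [h2]
  simp

theorem mvfderiv_frame {f : M → ℝ} (hf : ContDiffOn ℝ ∞ (f ∘ e.symm)
    e.target) (he : e ∈ atlas (EuclideanSpace ℝ (Fin n)) M)
    (hy : y ∈ e.target) (i : Fin n) :
    mvfderiv (𝓡 n) f (e.symm y) (frame e y i) =
      pd i (f ∘ e.symm) y := by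
  have hd := mdifferentiable_of_mem_atlas (I := 𝓡 n) he
  have hs := e.map_target hy
  have hfe : MDifferentiableAt 𝓘(ℝ, EuclideanSpace ℝ (Fin n)) 𝓘(ℝ, ℝ) (f ∘ e.symm)
      (e (e.symm y)) := by
    rw [e.right_inv hy]
    exact (differentiableAt_of_contDiffOn e.open_target hf hy).mdifferentiableAt
  have hmf : MDifferentiableAt (𝓡 n) 𝓘(ℝ, ℝ) f (e.symm y) := by
    refine (hfe.comp _ (hd.mdifferentiableAt hs)).congr_of_eventuallyEq ?_
    filter_upwards [e.open_source.mem_nhds hs] with p hp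
    simp [e.left_inv hp]
  have h := mvfderiv_comp_apply y hmf (hd.mdifferentiableAt_symm hy)
    (EuclideanSpace.single i (1 : ℝ) : EuclideanSpace ℝ (Fin n))
  refine h.symm.trans ?_
  change mfderiv 𝓘(ℝ, EuclideanSpace ℝ (Fin n)) 𝓘(ℝ, ℝ) (f ∘ e.symm) y _ = _
  rw [mfderiv_eq_fderiv]
  rfl

/-- The frame is the tangent map of `e.symm` applied to a constant vector field. -/
theorem contMDiffOn_frame (he : e ∈ atlas (EuclideanSpace ℝ (Fin n)) M) (i : Fin n) :
    ContMDiffOn 𝓘(ℝ, EuclideanSpace ℝ (Fin n)) ((𝓡 n).prod 𝓘(ℝ, EuclideanSpace ℝ (Fin n))) ∞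
      (fun y ↦ TotalSpace.mk' (EuclideanSpace ℝ (Fin n))
        (E := fun x : M ↦ TangentSpace (𝓡 n) x) (e.symm y) (frame e y i)) e.target := by
  have h1 := (contMDiffOn_symm_of_mem_maximalAtlas (I := 𝓡 n) (n := ∞)
      (IsManifold.subset_maximalAtlas he)).contMDiffOn_tangentMapWithin
    (m := ∞) le_rfl e.open_target.uniqueMDiffOn
  have h2 : ContMDiffOn 𝓘(ℝ, EuclideanSpace ℝ (Fin n))
      (𝓘(ℝ, EuclideanSpace ℝ (Fin n)).prod 𝓘(ℝ, EuclideanSpace ℝ (Fin n))) ∞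
      (fun y ↦ TotalSpace.mk' (EuclideanSpace ℝ (Fin n)) (E := fun x : EuclideanSpace ℝ (Fin n) ↦
        TangentSpace 𝓘(ℝ, EuclideanSpace ℝ (Fin n)) x) y
        (EuclideanSpace.single i (1 : ℝ) : EuclideanSpace ℝ (Fin n))) e.target :=
    contMDiffOn_vectorSpace_iff_contDiffOn.2 contDiffOn_const
  refine (h1.comp h2 fun y hy ↦ hy).congr fun y hy ↦ ?_
  simp only [Function.comp, tangentMapWithin, frame]
  rw [mfderivWithin_of_isOpen e.open_target hy]

theorem contDiffOn_formCoord {η : ∀ x : M, TangentSpace (𝓡 n) x →L[ℝ] ℝ} (hη : IsSmoothForm η)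
    (he : e ∈ atlas (EuclideanSpace ℝ (Fin n)) M) (i : Fin n) :
    ContDiffOn ℝ ∞ (formCoord η e i) e.target := by
  have h1 := (hη.contMDiffOn (s := Set.univ)).comp
    (contMDiffOn_symm_of_mem_maximalAtlas (I := 𝓡 n) (n := ∞)
      (IsManifold.subset_maximalAtlas he)) (fun _ _ ↦ Set.mem_univ _)
  have h2 := ContMDiffOn.clm_bundle_apply (E₂ := Bundle.Trivial M ℝ) (F₂ := ℝ) h1
    (contMDiffOn_frame he i)
  rw [← contMDiffOn_iff_contDiffOn]
  intro y hy
  have h3 := h2 y hy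
  rw [contMDiffWithinAt_totalSpace] at h3
  exact h3.2

variable (g : ContMDiffRiemannianMetric (𝓡 n) ∞ (EuclideanSpace ℝ (Fin n))
  (fun x : M ↦ TangentSpace (𝓡 n) x))

theorem contDiffOn_metricCoord (he : e ∈ atlas (EuclideanSpace ℝ (Fin n)) M) (i j : Fin n) :
    ContDiffOn ℝ ∞ (fun y ↦ metricCoord g e y i j) e.target := by
  have h1 := (g.contMDiff.contMDiffOn (s := Set.univ)).comp
    (contMDiffOn_symm_of_mem_maximalAtlas (I := 𝓡 n) (n := ∞)
      (IsManifold.subset_maximalAtlas he)) (fun _ _ ↦ Set.mem_univ _)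
  have h2 := ContMDiffOn.clm_bundle_apply₂ (E₃ := Bundle.Trivial M ℝ) (F₃ := ℝ) h1
    (contMDiffOn_frame he i) (contMDiffOn_frame he j)
  rw [← contMDiffOn_iff_contDiffOn]
  intro y hy
  have h3 := h2 y hy
  rw [contMDiffWithinAt_totalSpace] at h3
  exact h3.2

theorem inner_frame_sum (y : EuclideanSpace ℝ (Fin n)) (c d : Fin n → ℝ) :
    g.inner (e.symm y) (∑ i, c i • frame e y i)
      (∑ j, d j • frame e y j) =
    ∑ i, ∑ j, c i * d j * metricCoord g e y i j := by
  simp only [map_sum, _root_.sum_apply, map_smul, _root_.smul_apply, smul_eq_mul, metricCoord,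
    Matrix.of_apply, Finset.mul_sum]
  rw [Finset.sum_comm]
  exact Finset.sum_congr rfl fun i _ ↦ Finset.sum_congr rfl fun j _ ↦ by ring

theorem isMetricOn_metricCoord (he : e ∈ atlas (EuclideanSpace ℝ (Fin n)) M) :
    IsMetricOn (metricCoord g e) e.target where
  isOpen := e.open_target
  smooth := contDiffOn_metricCoord g he
  posDef y hy := by
    refine Matrix.PosDef.of_dotProduct_mulVec_pos ?_ fun c hc ↦ ?_
    · ext i j
      simpa [metricCoord] using g.symm _ _ _
    · have h := g.pos _ _ (frame_sum_ne_zero he hy hc)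
      rw [inner_frame_sum] at h
      simpa [dotProduct, Matrix.mulVec, Finset.mul_sum, mul_assoc, mul_left_comm, mul_comm]
        using h

theorem inner_sharp (x : M) (σ : TangentSpace (𝓡 n) x →L[ℝ] ℝ) (w : TangentSpace (𝓡 n) x) :
    g.inner x (sharp g x σ) w = σ w :=
  (exists_sharp g x σ).choose_spec w

theorem apply_sharp (x : M) (σ θ : TangentSpace (𝓡 n) x →L[ℝ] ℝ) :
    θ (sharp g x σ) = formInner g x θ σ :=
  (inner_sharp g x θ _).symm

/-- Expand θ* in the frame with coefficients c; then θ_j = c_i g_ij, so c is recovered with G⁻¹, and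
σ·θ = σ(θ*). -/
theorem formInner_eq_coordInner (he : e ∈ atlas (EuclideanSpace ℝ (Fin n)) M)
    (hy : y ∈ e.target)
    (σ θ : TangentSpace (𝓡 n) (e.symm y) →L[ℝ] ℝ) :
    formInner g (e.symm y) σ θ =
      coordInner (metricCoord g e) (fun i ↦ σ (frame e y i))
        (fun i ↦ θ (frame e y i)) y := by
  have hG := isMetricOn_metricCoord g he
  set G := metricCoord g e
  obtain ⟨c, hc⟩ := exists_frame_sum he hy (sharp g _ θ)
  have hθ : ∀ j, θ (frame e y j) = ∑ i, c i * G y i j := by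
    intro j
    rw [← inner_sharp g, hc]
    simp [G, metricCoord]
  have hcj : ∀ i, c i = ∑ j, (G y)⁻¹ i j * θ (frame e y j) := by
    intro i
    have hinv : ∀ k, ∑ j, (G y)⁻¹ i j * G y j k = if i = k then 1 else 0 := fun k ↦ by
      rw [← Matrix.mul_apply, hG.inv_mul hy, Matrix.one_apply]
    simp only [hθ, Finset.mul_sum]
    rw [Finset.sum_comm]
    have : ∀ k, ∑ j, (G y)⁻¹ i j * (c k * G y k j) = c k * if i = k then 1 else 0 := by
      intro k
      rw [← hinv k, Finset.mul_sum]
      exact Finset.sum_congr rfl fun j _ ↦ by rw [hG.symm hy k j]; ring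
    simp [this]
  rw [← apply_sharp, hc, map_sum, coordInner]
  refine Finset.sum_congr rfl fun i _ ↦ ?_
  rw [map_smul, smul_eq_mul, hcj, Finset.sum_mul]
  exact Finset.sum_congr rfl fun j _ ↦ by ring

/-- Needed because the coordinate expression of |η|² is valid only on the chart's target. -/
theorem genCoord_congr {U : Set (EuclideanSpace ℝ (Fin n))} (hU : IsOpen U) (hy : y ∈ U)
    (G : EuclideanSpace ℝ (Fin n) → Matrix (Fin n) (Fin n) ℝ)
    (psi : EuclideanSpace ℝ (Fin n) → ℝ) {f h : EuclideanSpace ℝ (Fin n) → ℝ}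
    (hfh : ∀ z ∈ U, f z = h z) :
    genCoord G psi f y = genCoord G psi h y := by
  have h1 : ∀ k, ∀ z ∈ U, pd k f z = pd k h z := fun k z hz ↦ pd_congr hU hfh hz k
  have h2 : ∀ l k, pd l (pd k f) y = pd l (pd k h) y := fun l k ↦ pd_congr hU (h1 k) hy l
  simp only [genCoord, hessCoord, covDeriv, h2, h1 _ y hy]

end Charts

end WeightedRiem

/-! ### Transfer of the coordinate inequality to the manifold. -/

theorem corollary3p5 {n : ℕ} {M : Type*} [TopologicalSpace M] [T2Space M] [CompactSpace M]
    [ConnectedSpace M] [ChartedSpace (EuclideanSpace ℝ (Fin n)) M] [IsManifold (𝓡 n) ∞ M]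
    (g : ContMDiffRiemannianMetric (𝓡 n) ∞ (EuclideanSpace ℝ (Fin n))
      (fun x : M ↦ TangentSpace (𝓡 n) x))
    (Psi : M → ℝ) (hPsi : ContMDiff (𝓡 n) 𝓘(ℝ, ℝ) ∞ Psi)
    (R m : ℝ) (hm : (n : ℝ) ≤ m) (hmn : m = n → Psi = 0)
    (hcurv : ∀ (x : M) (v : TangentSpace (𝓡 n) x),
      R * g.inner x v v + 1 / (m - n) * (mvfderiv (𝓡 n) Psi x v) ^ 2 ≤ bakryEmery g Psi x v v)
    (η α : ∀ x : M, TangentSpace (𝓡 n) x →L[ℝ] ℝ)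
    (hη : IsSmoothForm η) (hα : IsSmoothForm α) (b : ℝ) (x : M) :
    1 / m * (divForm g Psi η x + 2 * b * formInner g x (α x) (η x)) ^ 2
        + R * formInner g x (η x) (η x)
      ≤ gen g Psi (fun y ↦ formInner g y (η y) (η y) / 2) x
        - formInner g x (η x) (hodge g Psi η x)
        + 2 * b * formInner g x (α x) (mvfderiv (𝓡 n) (fun y ↦ formInner g y (η y) (η y)) x)
        + 4 * b ^ 2 * formInner g x (α x) (α x) * formInner g x (η x) (η x) := by
  set e := chartAt (EuclideanSpace ℝ (Fin n)) x
  have he : e ∈ atlas (EuclideanSpace ℝ (Fin n)) M := chart_mem_atlas _ x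
  have hx : x ∈ e.source := mem_chart_source _ x
  have hy : e x ∈ e.target := e.map_source hx
  have hG := isMetricOn_metricCoord g he
  set G := metricCoord g e
  have sη : ∀ i, ContDiffOn ℝ ∞ (formCoord η e i) e.target := contDiffOn_formCoord hη he
  have spsi : ContDiffOn ℝ ∞ (Psi ∘ e.symm) e.target := by
    rw [← contMDiffOn_iff_contDiffOn]
    exact hPsi.comp_contMDiffOn (contMDiffOn_symm_of_mem_maximalAtlas
      (IsManifold.subset_maximalAtlas he))
  -- The point `e.symm (e x)` equals x only propositionally, so the tangent spaces differ as types.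
  -- Stating this for fields of covectors lets the equality of points be transported by `congrArg`.
  have key : ∀ A B : ∀ p : M, TangentSpace (𝓡 n) p →L[ℝ] ℝ, formInner g x (A x) (B x) =
      coordInner G (fun i ↦ formCoord A e i (e x)) (fun i ↦ formCoord B e i (e x)) (e x) :=
    fun A B ↦ (congrArg (fun p ↦ formInner g p (A p) (B p)) (e.left_inv hx).symm).trans
      (formInner_eq_coordInner g he hy _ _)
  set f : M → ℝ := fun p ↦ formInner g p (η p) (η p)
  have hfU : ∀ z ∈ e.target, (f ∘ e.symm) z =
      coordInner G (fun i ↦ formCoord η e i z) (fun i ↦ formCoord η e i z) z :=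
    fun z hz ↦ formInner_eq_coordInner g he hz _ _
  have sf : ContDiffOn ℝ ∞ (f ∘ e.symm) e.target := (hG.smooth_coordInner sη sη).congr hfU
  have hdf : ∀ i, formCoord (mvfderiv (𝓡 n) f) e i (e x) = pd i (fun z ↦
      coordInner G (fun i ↦ formCoord η e i z) (fun i ↦ formCoord η e i z) z) (e x) := fun i ↦
    (mvfderiv_frame sf he hy i).trans (pd_congr e.open_target hfU hy i)
  have hdPsi : ∀ i, formCoord (mvfderiv (𝓡 n) Psi) e i (e x) = pd i (Psi ∘ e.symm) (e x) :=
    mvfderiv_frame spsi he hy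
  -- the coordinate differentials of the fixed chart `e`
  let C : Fin n → ∀ p : M, TangentSpace (𝓡 n) p →L[ℝ] ℝ := fun i p ↦
    (EuclideanSpace.proj i : EuclideanSpace ℝ (Fin n) →L[ℝ] ℝ).comp (mvfderiv (𝓡 n) e p)
  have hC : ∀ i j, formCoord (C i) e j (e x) = if i = j then 1 else 0 :=
    mvfderiv_chart_frame he hy
  -- A field extending the covector `hodge g Psi η x`, with coefficients frozen at `e x`, so that
  -- `key` applies to it.
  let W : ∀ p : M, TangentSpace (𝓡 n) p →L[ℝ] ℝ := fun p ↦
    ∑ i, hodgeCoord G (Psi ∘ e.symm) (formCoord η e) i (e x) • C i p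
  have hW : ∀ j, formCoord W e j (e x) = hodgeCoord G (Psi ∘ e.symm) (formCoord η e) j (e x) := by
    intro j
    have h : formCoord W e j (e x) = ∑ i, hodgeCoord G (Psi ∘ e.symm) (formCoord η e) i (e x) *
        formCoord (C i) e j (e x) := by
      simp only [formCoord, W, _root_.sum_apply, _root_.smul_apply, smul_eq_mul]
    simp [h, hC]
  have hcof : ∀ i, coframe x i (sharp g x (η x)) =
      ∑ j, (G (e x))⁻¹ i j * formCoord η e j (e x) := by
    intro i
    rw [apply_sharp]
    refine (key (C i) η).trans ?_
    simp [coordInner, hC]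
  have hbe : bakryEmery g Psi x (sharp g x (η x)) (sharp g x (η x)) =
      coordInner G (fun i ↦ formCoord η e i (e x)) (fun j ↦ ∑ i, ∑ p, (G (e x))⁻¹ i p *
        (ricciCoord G j i (e x) + hessCoord G (Psi ∘ e.symm) j i (e x)) *
        formCoord η e p (e x)) (e x) := by
    have h1 : bakryEmery g Psi x (sharp g x (η x)) (sharp g x (η x)) =
        ∑ j, ∑ i, (ricciCoord G j i (e x) + hessCoord G (Psi ∘ e.symm) j i (e x)) *
          coframe x j (sharp g x (η x)) * coframe x i (sharp g x (η x)) := rfl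
    rw [h1, hG.coordInner_comm hy, coordInner]
    simp only [hcof]
    refine Finset.sum_congr rfl fun j _ ↦ ?_
    have h2 : ∑ i, ∑ p, (G (e x))⁻¹ i p *
        (ricciCoord G j i (e x) + hessCoord G (Psi ∘ e.symm) j i (e x)) * formCoord η e p (e x) =
        ∑ i, (ricciCoord G j i (e x) + hessCoord G (Psi ∘ e.symm) j i (e x)) *
          ∑ p, (G (e x))⁻¹ i p * formCoord η e p (e x) := by
      simp only [Finset.mul_sum]
      exact Finset.sum_congr rfl fun i _ ↦ Finset.sum_congr rfl fun p _ ↦ by ring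
    rw [h2, Finset.sum_congr rfl fun a _ ↦ mul_right_comm _ _ _, ← Finset.sum_mul, Finset.mul_sum]
    exact Finset.sum_congr rfl fun i _ ↦ by ring
  -- Testing the curvature bound on η* turns dΨ(η*) into ∇Ψ·η and g(η*, η*) into |η|².
  have hc := hcurv x (sharp g x (η x))
  rw [apply_sharp g x _ (mvfderiv (𝓡 n) Psi x), hbe, key (mvfderiv (𝓡 n) Psi) η] at hc
  change R * formInner g x (η x) (η x) + _ ≤ _ at hc
  rw [key η η] at hc
  simp only [hdPsi] at hc
  have hpsi0 : m = n → ∀ i, pd i (Psi ∘ e.symm) (e x) = 0 := fun h i ↦ by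
    rw [hmn h]
    exact pd_const i 0
  have hmain := hG.bochner_le hy spsi sη (fun i ↦ formCoord α e i (e x)) R m b hm hpsi0 hc
  have hgen : gen g Psi (fun p ↦ f p / 2) x = genCoord G (Psi ∘ e.symm) (fun z ↦
      coordInner G (fun i ↦ formCoord η e i z) (fun i ↦ formCoord η e i z) z / 2) (e x) :=
    genCoord_congr e.open_target hy _ _ fun z hz ↦ congrArg (· / 2) (hfU z hz)
  have hhodge : formInner g x (η x) (hodge g Psi η x) =
      coordInner G (fun i ↦ formCoord η e i (e x))
        (fun i ↦ hodgeCoord G (Psi ∘ e.symm) (formCoord η e) i (e x)) (e x) := by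
    simp only [← hW]
    exact key η W
  rw [hgen, hhodge, key α (mvfderiv (𝓡 n) f), key α η, key α α, key η η]
  simp only [hdf]
  exact hmain
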